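/- Let $N\ge 2$, and let $T$ be the torus $\mathbb{R}^2/(N\mathbb{Z})^2$ with horizontal circles $\alpha_i=\{y=i-1\}$ and vertical circles $\beta_i=\{x=i-1\}$, $1\le i\le N$ (a toroidal grid diagram of index $N$; its markings play no role here). The elementary domains are the $N^2$ components of $T\setminus\bigcup_i(\alpha_i\cup\beta_i)$; the horizontal annulus $H_i$ (respectively the vertical annulus $V_i$) is the sum of the $N$ elementary domains directly above $\alpha_i$ (respectively directly to the right of $\beta_i$). A generator is a set of $N$ points (its coordinates) of the form $\{\alpha_i\cap\beta_{\sigma(i)}\}_{i}$ with $\sigma$ a permutation of $\{1,\ldots,N\}$. For generators $x,y$ sharing exactly $N-2$ coordinates, $\mathcal{R}(x,y)$ is the set of rectangles joining $x$ to $y$: sums (with coefficients $0$ and $1$) of elementary domains whose closure is an embedded rectangle in $T$ with bottom-left and top-right corners in $x$, top-left and bottom-right corners in $y$, and no coordinate of $x$ or $y$ in its interior; otherwise $\mathcal{R}(x,y)=\emptyset$. A sign assignment $s$ assigns to each pair of generators $x,y$ and each $R\in\mathcal{R}(x,y)$ a sign $s(R)\in\{-1,1\}$ such that, whenever $x,y,z,z'$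 are distinct generators and $R_1\in\mathcal{R}(x,z)$, $R_2\in\mathcal{R}(z,y)$, $R_1'\in\mathcal{R}(x,z')$, $R_2'\in\mathcal{R}(z',y)$ satisfy $R_1+R_2=R_1'+R_2'$, one has $s(R_1)s(R_2)=-s(R_1')s(R_2')$. Two sign assignments $s_1,s_2$ are gauge equivalent if there is a function $t$ from generators to $\{-1,1\}$ with $s_1(R)=t(x)t(y)s_2(R)$ for all $x,y$ and all $R\in\mathcal{R}(x,y)$. For each generator $x$ and each $i$, the 2-chain $H_i$ has a unique decomposition $H_i=R+R'$ with $R\in\mathcal{R}(x,z)$ and $R'\in\mathcal{R}(z,x)$ for some generator $z$; put $h_{s,x}(i)=s(R)s(R')$. Define $v_{s,x}(i)$ in the same way from $V_i$. These functions depend only on the gauge equivalence class of $s$ (and in fact not on $x$; the common functions are denoted $h_s$, $v_s$). Theorem. (1) For all functions $g_h,g_v:\{1,\ldots,N\}\to\{-1,1\}$ with $|g_v^{-1}(1)|\equiv|g_h^{-1}(-1)|\pmod 2$ there is a sign assignment $s$ with $h_s=g_h$ and $v_s=g_v$, that is, $h_{s,x}=g_h$ and $v_{s,x}=g_v$ for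 every generator $x$. (2) The map $\Phi$ from the set of gauge equivalence classes of sign assignments to $\{-1,1\}^{2N-1}$, $\Phi(s)=(h_s(1),\ldots,h_s(N),v_s(1),\ldots,v_s(N-1))$, is surjective (for whichever generator $x$ is used to compute $h_s=h_{s,x}$ and $v_s=v_{s,x}$). -/

import Mathlib

namespace Grid

/-- A generator of the toroidal grid diagram of index `N`: the permutation `x` stands for the tuple
of points `α_i ∩ β_{x i}`. The circles `α_i` (horizontal) and `β_j` (vertical) are indexed by
`Fin N`, whose addition is modulo `N`. -/
abbrev Generator (N : ℕ) := Equiv.Perm (Fin N)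

/-- The point `β_p ∩ α_q` (column `p`, row `q`) is one of the coordinates of `x`. -/
def IsCoord {N : ℕ} (x : Generator N) (p q : Fin N) : Prop := x q = p

/-- Integral 2-chains generated by the elementary domains. The elementary domain `(p, q)` is the
unit square whose bottom-left corner is `β_p ∩ α_q`, i.e. the intersection of the vertical annulus
`V_p` with the horizontal annulus `H_q`. -/
abbrev Chain (N : ℕ) := Fin N × Fin N → ℤ

/-- `H_i`: its bottom circle is `α_i`. -/
def horizontalAnnulus {N : ℕ} (i : Fin N) : Chain N := fun e => if e.2 = i then 1 else 0

/-- `V_i`: its left circle is `β_i`. -/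
def verticalAnnulus {N : ℕ} (i : Fin N) : Chain N := fun e => if e.1 = i then 1 else 0

/-- The 2-chain `R` is a rectangle joining `x` to `y`. Its left, right, bottom and top sides lie on
`β_a`, `β_c`, `α_b`, `α_d`. As subtraction in `Fin N` is modulo `N`, the number `p - a` is the
distance travelled to the right from `β_a` to `β_p`, and `c - a` is the width of the rectangle;
similarly upwards for the rows. The conditions `a ≠ c`, `b ≠ d` say that width and height are
strictly between `0` and `N`, i.e. that the closed rectangle is an embedded disk. -/
def IsRectangle {N : ℕ} [NeZero N] (x y : Generator N) (R : Chain N) : Prop :=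
  ∃ a c b d : Fin N, a ≠ c ∧ b ≠ d ∧
    (∀ p q : Fin N, R (p, q) = if p - a < c - a ∧ q - b < d - b then 1 else 0) ∧
    -- bottom-left and top-right corners
    IsCoord x a b ∧ IsCoord x c d ∧
    -- top-left and bottom-right corners
    IsCoord y a d ∧ IsCoord y c b ∧
    -- `x` and `y` share `N - 2` coordinates
    (Finset.univ.filter fun i => x i = y i).card + 2 = N ∧
    -- the interior contains no coordinate of `x` or `y`
    ∀ p q : Fin N, 0 < p - a → p - a < c - a → 0 < q - b → q - b < d - b →
      ¬ IsCoord x p q ∧ ¬ IsCoord y p q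

/-- The set of rectangles joining `x` to `y`. -/
def Rectangle {N : ℕ} [NeZero N] (x y : Generator N) := {R : Chain N // IsRectangle x y R}

/-- A sign assignment is a function on all rectangles, where a rectangle remembers the generators
that it joins. -/
structure SignAssignment (N : ℕ) [NeZero N] where
  sign : ∀ x y : Generator N, Rectangle x y → ℤˣ
  anticomm : ∀ x y z z' : Generator N, [x, y, z, z'].Nodup →
    ∀ (R₁ : Rectangle x z) (R₂ : Rectangle z y) (R₁' : Rectangle x z') (R₂' : Rectangle z' y),
      R₁.1 + R₂.1 = R₁'.1 + R₂'.1 →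
      sign x z R₁ * sign z y R₂ = -(sign x z' R₁' * sign z' y R₂')

/-- Gauge equivalence of sign assignments. -/
def GaugeEquivalent {N : ℕ} [NeZero N] (s₁ s₂ : SignAssignment N) : Prop :=
  ∃ t : Generator N → ℤˣ, ∀ (x y : Generator N) (R : Rectangle x y),
    s₁.sign x y R = t x * t y * s₂.sign x y R

/-- The setoid of gauge equivalence. -/
def gaugeSetoid (N : ℕ) [NeZero N] : Setoid (SignAssignment N) where
  r := GaugeEquivalent
  iseqv :=
    { refl := fun s => ⟨fun _ => 1, fun x y R => by simp⟩
      symm := by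
        rintro s₁ s₂ ⟨t, ht⟩
        refine ⟨t, fun x y R => ?_⟩
        rw [ht, ← mul_assoc, mul_mul_mul_comm, Int.units_mul_self, Int.units_mul_self]
        simp
      trans := by
        rintro s₁ s₂ s₃ ⟨t, ht⟩ ⟨u, hu⟩
        refine ⟨fun x => t x * u x, fun x y R => ?_⟩
        rw [ht, hu, ← mul_assoc, mul_mul_mul_comm] }

/-- The gauge equivalence classes of sign assignments. -/
abbrev GaugeClass (N : ℕ) [NeZero N] := Quotient (gaugeSetoid N)

/-- A decomposition of the 2-chain `D` as a sum of a rectangle joining `x` to some generator `z`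
and a rectangle joining `z` to `y`. -/
structure Decomposition {N : ℕ} [NeZero N] (x y : Generator N) (D : Chain N) where
  mid : Generator N
  fst : Rectangle x mid
  snd : Rectangle mid y
  sum_eq : fst.1 + snd.1 = D

/-- The product of the signs of the two rectangles of a decomposition. -/
def Decomposition.sign {N : ℕ} [NeZero N] {x y : Generator N} {D : Chain N}
    (d : Decomposition x y D) (s : SignAssignment N) : ℤˣ :=
  s.sign x d.mid d.fst * s.sign d.mid y d.snd

theorem Decomposition.ext_chain {N : ℕ} [NeZero N] {x y : Generator N} {D : Chain N}
    {d d' : Decomposition x y D} (hmid : d.mid = d'.mid) (hfst : d.fst.1 = d'.fst.1) : d = d' := by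
  obtain ⟨z, R₁, R₂, h⟩ := d
  obtain ⟨z', R₁', R₂', h'⟩ := d'
  dsimp only at hmid hfst
  subst hmid
  obtain rfl : R₁ = R₁' := Subtype.ext hfst
  obtain rfl : R₂ = R₂' := Subtype.ext (add_left_cancel (h.trans h'.symm))
  rfl

theorem val_sub_eq {N : ℕ} (p a : Fin N) :
    ((p - a : Fin N) : ℕ) = if (a : ℕ) ≤ p then (p : ℕ) - a else N + p - a := by
  split_ifs with h
  · exact Fin.coe_sub_iff_le.2 h
  · exact Fin.coe_sub_iff_lt.2 (not_le.1 h)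

theorem sub_lt_add {N : ℕ} {a c : Fin N} (hac : a ≠ c) (p : Fin N) :
    ((if p - a < c - a then 1 else 0) + (if p - c < a - c then 1 else 0) : ℤ) = 1 := by
  have h : (p - a < c - a) ↔ ¬ (p - c < a - c) := by
    have h' : (a : ℕ) ≠ c := fun h => hac (Fin.ext h)
    have := p.2; have := a.2; have := c.2
    simp only [Fin.lt_def, val_sub_eq]
    split_ifs <;> omega
  by_cases h₁ : p - c < a - c <;> simp [h, h₁]

theorem val_one_eq {N : ℕ} [N.AtLeastTwo] : ((1 : Fin N) : ℕ) = 1 := by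
  rw [Fin.val_one', Nat.mod_eq_of_lt (Nat.AtLeastTwo.prop (n := N))]

theorem lt_one_iff_eq {N : ℕ} [N.AtLeastTwo] (p a : Fin N) : p - a < a + 1 - a ↔ p = a := by
  rw [add_sub_cancel_left, Fin.lt_def, val_one_eq, Nat.lt_one_iff, ← sub_eq_zero (a := p),
    Fin.ext_iff, Fin.val_zero]

theorem ne_add_one {N : ℕ} [N.AtLeastTwo] (a : Fin N) : a ≠ a + 1 := by
  intro h
  have h' : (1 : Fin N) = 0 := by simpa using h.symm
  have := congrArg Fin.val h'
  rw [val_one_eq, Fin.val_zero] at this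
  omega

/-- A nonempty cyclic interval from `a` to `c` that is contained in `{i}` goes from `i` to
`i + 1`. -/
theorem eq_of_interval {N : ℕ} [N.AtLeastTwo] {a c i : Fin N} (hac : a ≠ c)
    (h : ∀ p, p - a < c - a → p = i) : a = i ∧ c = i + 1 := by
  have hpos : 0 < c - a := by
    rw [Fin.pos_iff_ne_zero]
    exact sub_ne_zero.2 hac.symm
  have ha : a = i := h a (by simpa using hpos)
  subst ha
  refine ⟨rfl, ?_⟩
  by_contra hc
  have hne : ¬ (a + 1 - a < c - a) := fun hlt => ne_add_one a (h _ hlt).symm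
  rw [add_sub_cancel_left] at hne
  have h1 : c - a ≠ 1 := fun h1 => hc (by rw [← h1]; abel)
  have h1' : ((c - a : Fin N) : ℕ) ≠ 1 := fun h => h1 (Fin.ext (by rw [h, val_one_eq]))
  rw [Fin.lt_def, val_one_eq] at hne
  rw [Fin.lt_def, Fin.val_zero] at hpos
  omega

theorem IsRectangle.generator_eq {N : ℕ} {x y : Generator N}
    {a c b d : Fin N} (hbd : b ≠ d)
    (hx₁ : x b = a) (hx₂ : x d = c) (hy₁ : y d = a) (hy₂ : y b = c)
    (hy : (Finset.univ.filter fun i => x i = y i).card + 2 = N) :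
    y = x * Equiv.swap b d := by
  have hac : a ≠ c := by
    rintro rfl
    exact hbd (x.injective (hx₁.trans hx₂.symm))
  have hsub : (Finset.univ.filter fun i => x i = y i) ⊆ (Finset.univ.erase b).erase d := by
    intro i hi
    simp only [Finset.mem_filter, Finset.mem_univ, true_and] at hi
    simp only [Finset.mem_erase, Finset.mem_univ, and_true]
    refine ⟨?_, ?_⟩ <;> rintro rfl <;> simp_all
  have hcard : ((Finset.univ.erase b).erase d).card + 2 = N := by
    rw [Finset.card_erase_of_mem (by simp [hbd.symm]), Finset.card_erase_of_mem (by simp),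
      Finset.card_univ, Fintype.card_fin]
    have := b.2; have := d.2
    have : (b : ℕ) ≠ d := fun h => hbd (Fin.ext h)
    omega
  have heq := Finset.eq_of_subset_of_card_le hsub (by omega)
  ext i : 1
  by_cases hb : i = b
  · subst hb; simp [hy₂, hx₂]
  by_cases hd : i = d
  · subst hd; simp [hy₁, hx₁]
  have : i ∈ (Finset.univ.filter fun i => x i = y i) := by rw [heq]; simp [hb, hd]
  simp only [Finset.mem_filter, Finset.mem_univ, true_and] at this
  rw [← this, Equiv.Perm.mul_apply, Equiv.swap_apply_of_ne_of_ne hb hd]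

/-- The indicator of the rectangle with sides on `β_a`, `β_c`, `α_b`, `α_d`. -/
def block {N : ℕ} (a c b d : Fin N) : Chain N :=
  fun e => if e.1 - a < c - a ∧ e.2 - b < d - b then 1 else 0

theorem isRectangle_block {N : ℕ} [NeZero N] (x : Generator N) {b d : Fin N} (hbd : b ≠ d)
    (h : ∀ p q : Fin N, 0 < p - x b → p - x b < x d - x b → 0 < q - b → ¬ q - b < d - b) :
    IsRectangle x (x * Equiv.swap b d) (block (x b) (x d) b d) := by
  refine ⟨x b, x d, b, d, x.injective.ne hbd, hbd, fun p q => rfl, rfl, rfl, by simp [IsCoord],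
    by simp [IsCoord], ?_, fun p q h₁ h₂ h₃ h₄ => absurd h₄ (h p q h₁ h₂ h₃)⟩
  have : (Finset.univ.filter fun i => x i = (x * Equiv.swap b d) i) =
      (Finset.univ.erase b).erase d := by
    ext i
    by_cases hb : i = b
    · subst hb; simp [hbd]
    by_cases hd : i = d
    · subst hd; simp [hbd.symm]
    simp [hb, hd, Equiv.swap_apply_of_ne_of_ne hb hd]
  rw [this, Finset.card_erase_of_mem (by simp [hbd.symm]), Finset.card_erase_of_mem (by simp),
    Finset.card_univ, Fintype.card_fin]
  have := b.2; have := d.2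
  have : (b : ℕ) ≠ d := fun h => hbd (Fin.ext h)
  omega

theorem not_pos_of_lt {N : ℕ} [N.AtLeastTwo] {q b : Fin N} (h : 0 < q - b) :
    ¬ q - b < b + 1 - b := by
  rw [lt_one_iff_eq]
  rintro rfl
  simp at h

/-- The rectangles of a decomposition of `D` lie in the support of `D`. -/
theorem Decomposition.zero_of_zero {N : ℕ} [NeZero N] {x y : Generator N} {D : Chain N}
    (d : Decomposition x y D) {e : Fin N × Fin N} (he : D e = 0) : d.fst.1 e = 0 := by
  have h := congrFun d.sum_eq e
  rw [he] at h
  have h₁ : 0 ≤ d.fst.1 e := by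
    obtain ⟨_, _, _, _, _, _, hR, _⟩ := d.fst.2
    rw [hR e.1 e.2]; split_ifs <;> simp
  have h₂ : 0 ≤ d.snd.1 e := by
    obtain ⟨_, _, _, _, _, _, hR, _⟩ := d.snd.2
    rw [hR e.1 e.2]; split_ifs <;> simp
  change d.fst.1 e + d.snd.1 e = 0 at h
  omega

/-- For every generator `x`, the horizontal annulus `H_i` has exactly one decomposition as a sum of
a rectangle from `x` and a rectangle back to `x`. -/
theorem exists_unique_horizontal {N : ℕ} [N.AtLeastTwo] (x : Generator N) (i : Fin N) :
    ∃ d : Decomposition x x (horizontalAnnulus i), ∀ d', d' = d := by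
  have hi := ne_add_one i
  have h₂ : IsRectangle (x * Equiv.swap i (i + 1)) x
      (block (x (i + 1)) (x i) i (i + 1)) := by
    simpa [mul_assoc] using
      isRectangle_block (x * Equiv.swap i (i + 1)) hi (fun _ _ _ _ h => not_pos_of_lt h)
  refine ⟨⟨x * Equiv.swap i (i + 1), ⟨_, isRectangle_block x hi (fun _ _ _ _ h => not_pos_of_lt h)⟩,
    ⟨_, h₂⟩, ?_⟩, fun d => ?_⟩
  · funext ⟨p, q⟩
    have := sub_lt_add (x.injective.ne hi) p
    simp only [block, Pi.add_apply, horizontalAnnulus, lt_one_iff_eq]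
    by_cases hq : q = i <;> simp_all
  · obtain ⟨a, c, b, e, hac, hbe, hR, hx₁, hx₂, hy₁, hy₂, hcard, -⟩ := d.fst.2
    obtain ⟨rfl, rfl⟩ : b = i ∧ e = i + 1 := by
      refine eq_of_interval hbe fun q hq => ?_
      by_contra hne
      have h0 := d.zero_of_zero (e := (a, q)) (by simp [horizontalAnnulus, hne])
      have hpos : a - a < c - a := by
        rw [sub_self, Fin.pos_iff_ne_zero]
        exact sub_ne_zero.2 hac.symm
      rw [hR, if_pos ⟨hpos, hq⟩] at h0
      exact one_ne_zero h0
    refine Decomposition.ext_chain (IsRectangle.generator_eq hbe hx₁ hx₂ hy₁ hy₂ hcard) ?_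
    funext ⟨p, q⟩
    rw [hR, ← hx₁, ← hx₂]
    rfl

/-- For every generator `x`, the vertical annulus `V_i` has exactly one decomposition as a sum of
a rectangle from `x` and a rectangle back to `x`. -/
theorem exists_unique_vertical {N : ℕ} [N.AtLeastTwo] (x : Generator N) (i : Fin N) :
    ∃ d : Decomposition x x (verticalAnnulus i), ∀ d', d' = d := by
  obtain ⟨b, rfl⟩ := x.surjective i
  obtain ⟨e, he⟩ := x.surjective (x b + 1)
  have hbe : b ≠ e := by
    rintro rfl
    exact ne_add_one _ he
  have h₁ : IsRectangle x (x * Equiv.swap b e) (block (x b) (x b + 1) b e) := by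
    have := isRectangle_block x hbe (fun p _ h h' => by
      rw [he] at h'
      exact absurd h' (not_pos_of_lt h))
    rwa [he] at this
  have h₂ : IsRectangle (x * Equiv.swap b e) x (block (x b) (x b + 1) e b) := by
    have := isRectangle_block (x * Equiv.swap b e) hbe.symm (fun p _ h h' => by
      simp only [Equiv.Perm.mul_apply, Equiv.swap_apply_left, Equiv.swap_apply_right, he] at h h'
      exact absurd h' (not_pos_of_lt h))
    rw [Equiv.swap_comm e b, mul_assoc, Equiv.swap_mul_self, mul_one] at this
    simpa [he] using this
  refine ⟨⟨x * Equiv.swap b e, ⟨_, h₁⟩, ⟨_, h₂⟩, ?_⟩, fun d => ?_⟩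
  · funext ⟨p, q⟩
    have := sub_lt_add hbe q
    simp only [block, Pi.add_apply, verticalAnnulus, lt_one_iff_eq]
    by_cases hp : p = x b <;> simp_all
  · obtain ⟨a, c, b', e', hac, hbe', hR, hx₁, hx₂, hy₁, hy₂, hcard, -⟩ := d.fst.2
    obtain ⟨ha, hc⟩ : a = x b ∧ c = x b + 1 := by
      refine eq_of_interval hac fun p hp => ?_
      by_contra hne
      have h0 := d.zero_of_zero (e := (p, b')) (by simp [verticalAnnulus, hne])
      have hpos : b' - b' < e' - b' := by
        rw [sub_self, Fin.pos_iff_ne_zero]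
        exact sub_ne_zero.2 hbe'.symm
      rw [hR, if_pos ⟨hp, hpos⟩] at h0
      exact one_ne_zero h0
    obtain rfl : b' = b := x.injective (hx₁.trans ha)
    obtain rfl : e' = e := x.injective (hx₂.trans (hc.trans he.symm))
    refine Decomposition.ext_chain (IsRectangle.generator_eq hbe hx₁ hx₂ hy₁ hy₂ hcard) ?_
    funext ⟨p, q⟩
    rw [hR, ha, hc]
    rfl

/-- The horizontal function `h_{s,x}`: the product of the signs of the two rectangles in the unique
decomposition of `H_i`. -/
noncomputable def horizontal {N : ℕ} [N.AtLeastTwo] (s : SignAssignment N) (x : Generator N)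
    (i : Fin N) : ℤˣ :=
  (exists_unique_horizontal x i).choose.sign s

/-- The vertical function `v_{s,x}`: the product of the signs of the two rectangles in the unique
decomposition of `V_i`. -/
noncomputable def vertical {N : ℕ} [N.AtLeastTwo] (s : SignAssignment N) (x : Generator N)
    (i : Fin N) : ℤˣ :=
  (exists_unique_vertical x i).choose.sign s

theorem GaugeEquivalent.sign_eq {N : ℕ} [NeZero N] {s₁ s₂ : SignAssignment N}
    (h : GaugeEquivalent s₁ s₂) {x : Generator N} {D : Chain N} (d : Decomposition x x D) :
    d.sign s₁ = d.sign s₂ := by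
  obtain ⟨t, ht⟩ := h
  rw [Decomposition.sign, Decomposition.sign, ht, ht, mul_mul_mul_comm, mul_comm (t d.mid) (t x),
    Int.units_mul_self, one_mul]

/-- The map `Φ` from gauge equivalence classes of sign assignments to `{-1, 1}^(2N - 1)` given by
`(h(1), …, h(N), v(1), …, v(N - 1))`, where `h` and `v` are computed at the generator `x`. -/
noncomputable def Phi {N : ℕ} [N.AtLeastTwo] (x : Generator N) :
    GaugeClass N → (Fin N → ℤˣ) × (Fin (N - 1) → ℤˣ) :=
  Quotient.lift
    (fun s => (horizontal s x, fun j => vertical s x (Fin.castLE (Nat.sub_le N 1) j)))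
    (fun _ _ h => Prod.ext (funext fun _ => GaugeEquivalent.sign_eq h _)
      (funext fun _ => GaugeEquivalent.sign_eq h _))

end Grid

/-!
A sign assignment is first extracted from the spin extension of the symmetric group. In the Clifford
algebra of `ℝ^N` with `γ i ^ 2 = 1`, the unit vectors `τ b d = (γ b - γ d) / √2` lift the
transpositions `(b d)`. They square to `1`, satisfy `τ d b = -τ b d`, anticommute when disjoint, and
satisfy `τ i j * τ j k = τ j k * τ k i`. These relations reduce every product of the `τ b d` with
trivial underlying permutation to `1` or `-1` (`SpinLift.eq_one_or_eq_neg_one`), so that once a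
lift `lift x` of each permutation `x` has been chosen there are signs with
`lift x * τ b d = ± lift (x * swap b d)`. This sign, for `b` and `d` the bottom and top rows of a
rectangle from `x`, is the sign of the rectangle.

Anticommutation becomes the identity `τ b₁ d₁ * τ b₂ d₂ = -(τ b₁' d₁' * τ b₂' d₂')`
(`swapLift_mul_swapLift_eq_neg`). Either the rows form two disjoint pairs and the two rectangles are
exchanged, or there are three rows and the two pairs of rectangles come from different
factorizations of a 3-cycle. In both cases equality of the 2-chains restricts the orientations
`b, d` to those for which the identity holds; this is seen at finitely many elementary domains. The
values on annuli are `h = 1`, because `τ b d` squares to `1`, and `v = -1`, because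
`τ b d * τ d b = -1`.

Finally, any choice of signs on the elementary domains, extended multiplicatively to 2-chains,
twists a sign assignment into another one (`SignAssignment.twist`), multiplying `h i` and `v i` by the
row and column products of the choice. The only constraint between row and column products is that their
total products agree, which is the parity condition. Prescribing all of `h` and all but one value of
`v` leaves one value of `v` to meet it.
-/

namespace Grid

/-! ### Relations between transpositions -/

theorem swap_cyclic {n : Type*} [DecidableEq n] {i j k : n} (hij : i ≠ j) (hjk : j ≠ k)
    (hik : i ≠ k) : Equiv.swap i j * Equiv.swap j k = Equiv.swap j k * Equiv.swap k i := by
  ext m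
  grind [Equiv.Perm.mul_apply]

theorem swap_commute {n : Type*} [DecidableEq n] {i j k l : n} (hik : i ≠ k) (hil : i ≠ l)
    (hjk : j ≠ k) (hjl : j ≠ l) :
    Equiv.swap i j * Equiv.swap k l = Equiv.swap k l * Equiv.swap i j := by
  ext m
  grind [Equiv.Perm.mul_apply]

/-- `{b, d} = {i, j}` as unordered pairs: `b, d` are the bottom and top rows of a rectangle that
transposes the rows `i` and `j`. -/
def Joins {n : Type*} (b d i j : n) : Prop := b = i ∧ d = j ∨ b = j ∧ d = i

theorem Joins.swap_eq {n : Type*} [DecidableEq n] {b d i j : n} (h : Joins b d i j) :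
    Equiv.swap b d = Equiv.swap i j := by
  obtain ⟨rfl, rfl⟩ | ⟨rfl, rfl⟩ := h
  · rfl
  · exact Equiv.swap_comm _ _

theorem swap_cases {n : Type*} [DecidableEq n] (b d m : n) :
    m = b ∧ Equiv.swap b d m = d ∨ m = d ∧ Equiv.swap b d m = b ∨
      m ≠ b ∧ m ≠ d ∧ Equiv.swap b d m = m := by
  grind

/-- A 3-cycle has exactly three factorizations into two transpositions. -/
theorem joins_of_three_cycle {n : Type*} [DecidableEq n] {i j k b₁ d₁ b₂ d₂ : n} (hij : i ≠ j)
    (hjk : j ≠ k) (hik : i ≠ k)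
    (h : Equiv.swap i j * Equiv.swap j k = Equiv.swap b₁ d₁ * Equiv.swap b₂ d₂)
    (hne : ¬ Joins b₁ d₁ i j) :
    Joins b₁ d₁ j k ∧ Joins b₂ d₂ k i ∨ Joins b₁ d₁ k i ∧ Joins b₂ d₂ i j := by
  -- the second transposition is determined by the first, and each of them moves two points only
  have hp : ∀ m, Equiv.swap b₂ d₂ m = Equiv.swap b₁ d₁ (Equiv.swap i j (Equiv.swap j k m)) := by
    intro m
    rw [← Equiv.Perm.mul_apply _ _ m, h, Equiv.Perm.mul_apply, Equiv.swap_apply_self]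
  have hi : Equiv.swap b₂ d₂ i = Equiv.swap b₁ d₁ j := by
    rw [hp, Equiv.swap_apply_of_ne_of_ne hij hik, Equiv.swap_apply_left]
  have hj : Equiv.swap b₂ d₂ j = Equiv.swap b₁ d₁ k := by
    rw [hp, Equiv.swap_apply_left, Equiv.swap_apply_of_ne_of_ne hik.symm hjk.symm]
  have hk : Equiv.swap b₂ d₂ k = Equiv.swap b₁ d₁ i := by
    rw [hp, Equiv.swap_apply_right, Equiv.swap_apply_right]
  have si := swap_cases b₁ d₁ i
  have sj := swap_cases b₁ d₁ j
  have sk := swap_cases b₁ d₁ k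
  have ti := swap_cases b₂ d₂ i
  have tj := swap_cases b₂ d₂ j
  have tk := swap_cases b₂ d₂ k
  rw [hi] at ti
  rw [hj] at tj
  rw [hk] at tk
  generalize Equiv.swap b₁ d₁ i = u at *
  generalize Equiv.swap b₁ d₁ j = v at *
  generalize Equiv.swap b₁ d₁ k = w at *
  clear hp h hi hj hk
  unfold Joins at *
  grind (splits := 30)

/-- A product of two disjoint transpositions has no other factorization into two transpositions than
these two in either order. -/
theorem joins_of_disjoint {n : Type*} [DecidableEq n] {i j k l b₁ d₁ b₂ d₂ : n} (hij : i ≠ j)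
    (hkl : k ≠ l) (hik : i ≠ k) (hil : i ≠ l) (hjk : j ≠ k) (hjl : j ≠ l)
    (h : Equiv.swap i j * Equiv.swap k l = Equiv.swap b₁ d₁ * Equiv.swap b₂ d₂)
    (hne : ¬ Joins b₁ d₁ i j) :
    Joins b₁ d₁ k l ∧ Joins b₂ d₂ i j := by
  -- the second transposition is determined by the first, and each of them moves two points only
  have hp : ∀ m, Equiv.swap b₂ d₂ m = Equiv.swap b₁ d₁ (Equiv.swap i j (Equiv.swap k l m)) := by
    intro m
    rw [← Equiv.Perm.mul_apply _ _ m, h, Equiv.Perm.mul_apply, Equiv.swap_apply_self]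
  have hi : Equiv.swap b₂ d₂ i = Equiv.swap b₁ d₁ j := by
    rw [hp, Equiv.swap_apply_of_ne_of_ne hik hil, Equiv.swap_apply_left]
  have hj : Equiv.swap b₂ d₂ j = Equiv.swap b₁ d₁ i := by
    rw [hp, Equiv.swap_apply_of_ne_of_ne hjk hjl, Equiv.swap_apply_right]
  have hk : Equiv.swap b₂ d₂ k = Equiv.swap b₁ d₁ l := by
    rw [hp, Equiv.swap_apply_left, Equiv.swap_apply_of_ne_of_ne hil.symm hjl.symm]
  have hl : Equiv.swap b₂ d₂ l = Equiv.swap b₁ d₁ k := by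
    rw [hp, Equiv.swap_apply_right, Equiv.swap_apply_of_ne_of_ne hik.symm hjk.symm]
  have si := swap_cases b₁ d₁ i
  have sj := swap_cases b₁ d₁ j
  have sk := swap_cases b₁ d₁ k
  have sl := swap_cases b₁ d₁ l
  have ti := swap_cases b₂ d₂ i
  have tj := swap_cases b₂ d₂ j
  have tk := swap_cases b₂ d₂ k
  have tl := swap_cases b₂ d₂ l
  rw [hi] at ti
  rw [hj] at tj
  rw [hk] at tk
  rw [hl] at tl
  generalize Equiv.swap b₁ d₁ i = u at *
  generalize Equiv.swap b₁ d₁ j = v at *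
  generalize Equiv.swap b₁ d₁ k = w at *
  generalize Equiv.swap b₁ d₁ l = z at *
  clear hp h hi hj hk
  unfold Joins at *
  grind (splits := 30)

/-! ### The spin extension of the symmetric group -/

section Spin

variable {n : Type*} [Fintype n] [DecidableEq n]

/-- The sum of squares `∑ i, v i ^ 2`. -/
abbrev euclideanForm (n : Type*) [Fintype n] : QuadraticForm ℝ (n → ℝ) :=
  QuadraticMap.weightedSumSquares ℝ (fun _ : n => (1 : ℝ))

/-- The generator `γ i` of the Clifford algebra given by the `i`-th standard basis vector. -/
noncomputable def gen (i : n) : CliffordAlgebra (euclideanForm n) :=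
  CliffordAlgebra.ι (euclideanForm n) (Pi.single i 1)

theorem gen_mul_self (i : n) : gen i * gen i = 1 := by
  rw [gen, CliffordAlgebra.ι_sq_scalar]
  simp [QuadraticMap.weightedSumSquares_apply, Pi.single_apply]

theorem gen_mul_gen {i j : n} (h : i ≠ j) : gen i * gen j = -(gen j * gen i) := by
  refine CliffordAlgebra.ι_mul_ι_comm_of_isOrtho ?_
  rw [QuadraticMap.isOrtho_def]
  simp only [QuadraticMap.weightedSumSquares_apply, Pi.add_apply, one_smul,
    ← Finset.sum_add_distrib]
  refine Finset.sum_congr rfl fun k _ => ?_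
  have : (Pi.single i 1 : n → ℝ) k * (Pi.single j 1 : n → ℝ) k = 0 := by
    by_cases hk : k = i
    · subst hk; simp [h]
    · simp [hk]
  linear_combination 2 * this

/-- The unit vector `(γ i - γ j) / √2`, a lift of the transposition `(i j)` to the pin group. Unlike
the transposition, it depends on the order of `i` and `j`. -/
noncomputable def swapLift (i j : n) : CliffordAlgebra (euclideanForm n) :=
  (√2)⁻¹ • (gen i - gen j)

theorem swapLift_mul_swapLift (i j k l : n) :
    swapLift i j * swapLift k l = (2⁻¹ : ℝ) • ((gen i - gen j) * (gen k - gen l)) := by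
  rw [swapLift, swapLift, smul_mul_smul_comm, ← mul_inv, Real.mul_self_sqrt zero_le_two]

theorem swapLift_symm (i j : n) : swapLift j i = -swapLift i j := by
  rw [swapLift, swapLift, ← smul_neg, neg_sub]

theorem swapLift_mul_self {i j : n} (h : i ≠ j) : swapLift i j * swapLift i j = 1 := by
  rw [swapLift_mul_swapLift, mul_sub, sub_mul, sub_mul, gen_mul_self, gen_mul_self,
    gen_mul_gen h.symm, inv_smul_eq_iff₀ two_ne_zero, two_smul]
  abel

theorem swapLift_anticomm {i j k l : n} (hik : i ≠ k) (hil : i ≠ l) (hjk : j ≠ k) (hjl : j ≠ l) :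
    swapLift i j * swapLift k l = -(swapLift k l * swapLift i j) := by
  rw [swapLift_mul_swapLift, swapLift_mul_swapLift, ← smul_neg]
  congr 1
  simp only [mul_sub, sub_mul, gen_mul_gen hik, gen_mul_gen hil, gen_mul_gen hjk, gen_mul_gen hjl]
  abel

theorem swapLift_cyclic {i j k : n} (hij : i ≠ j) (hjk : j ≠ k) (hik : i ≠ k) :
    swapLift i j * swapLift j k = swapLift j k * swapLift k i := by
  rw [swapLift_mul_swapLift, swapLift_mul_swapLift]
  congr 1
  simp only [mul_sub, sub_mul, gen_mul_self, gen_mul_gen hij, gen_mul_gen hjk, gen_mul_gen hik]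
  abel

/-- `SpinLift A u x` says that, up to sign, `u` is a product of lifts of transpositions of elements
of `A`, and that `x` is the product of these transpositions: `u` lifts `x` to the spin extension of
the symmetric group. -/
inductive SpinLift (A : Set n) : CliffordAlgebra (euclideanForm n) → Equiv.Perm n → Prop
  | one : SpinLift A 1 1
  | neg {u x} : SpinLift A u x → SpinLift A (-u) x
  | mul {u x b d} : SpinLift A u x → b ∈ A → d ∈ A → b ≠ d →
      SpinLift A (u * swapLift b d) (x * Equiv.swap b d)

theorem SpinLift.apply_eq {A : Set n} {u x} (h : SpinLift A u x) {m : n} (hm : m ∉ A) :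
    x m = m := by
  induction h with
  | one => rfl
  | neg _ ih => exact ih
  | mul _ hb hd _ ih =>
    rw [Equiv.Perm.mul_apply, Equiv.swap_apply_of_ne_of_ne, ih]
    · rintro rfl; exact hm hb
    · rintro rfl; exact hm hd

/-- A lift over `insert m A` can be rewritten, by the relations between the `swapLift i j`, so that
`m` occurs in its last factor only. -/
theorem SpinLift.insert_cases {A : Set n} {m : n} (hm : m ∉ A) {u x}
    (h : SpinLift (insert m A) u x) :
    SpinLift A u x ∨ ∃ k ∈ A, ∃ v y, SpinLift A v y ∧ u = v * swapLift k m ∧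
      x = y * Equiv.swap k m := by
  induction h with
  | one => exact Or.inl .one
  | neg _ ih =>
    obtain h | ⟨k, hk, v, y, h, rfl, rfl⟩ := ih
    · exact Or.inl h.neg
    · exact Or.inr ⟨k, hk, -v, y, h.neg, by rw [neg_mul], rfl⟩
  | @mul u x b d _ hb hd hbd ih =>
    -- the orientation of the last transposition may be chosen so that it does not start at `m`
    wlog hbm : b ≠ m generalizing b d
    · have := this hd hb hbd.symm (by rintro rfl; exact hbd (not_not.1 hbm))
      rw [swapLift_symm, Equiv.swap_comm]
      obtain h | ⟨k, hk, v, y, h, hv, hy⟩ := this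
      · left; simpa using h.neg
      · exact Or.inr ⟨k, hk, -v, y, h.neg, by rw [mul_neg, hv, neg_mul], hy⟩
    replace hb : b ∈ A := hb.resolve_left hbm
    obtain h | ⟨k, hk, v, y, h, rfl, rfl⟩ := ih
    · obtain rfl | hd := hd
      · exact Or.inr ⟨b, hb, _, _, h, rfl, rfl⟩
      · exact Or.inl (h.mul hb hd hbd)
    have hkm : k ≠ m := fun e => hm (e ▸ hk)
    obtain rfl | hd := hd
    · by_cases hbk : b = k
      · subst hbk
        left
        rwa [mul_assoc, swapLift_mul_self hkm, mul_one, mul_assoc, Equiv.swap_mul_self, mul_one]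
      · refine Or.inr ⟨k, hk, _, _, (h.mul hb hk hbk).neg, ?_, ?_⟩
        · rw [swapLift_symm d b, mul_neg, mul_assoc, neg_mul, mul_assoc,
            swapLift_cyclic hbk hkm hbm]
        · rw [mul_assoc, mul_assoc]
          congr 1
          rw [swap_cyclic hbk hkm hbm, Equiv.swap_comm d b]
    · have hdm : d ≠ m := fun e => hm (e ▸ hd)
      by_cases hbk : b = k
      · subst hbk
        refine Or.inr ⟨d, hd, _, _, (h.mul hb hd hbd).neg, ?_, ?_⟩
        · rw [mul_assoc, neg_mul, mul_assoc, ← swapLift_cyclic hkm.symm hbd hdm.symm,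
            swapLift_symm b m, neg_mul, mul_neg, neg_neg]
        · rw [mul_assoc, mul_assoc, ← swap_cyclic hkm.symm hbd hdm.symm, Equiv.swap_comm m b]
      by_cases hdk : d = k
      · subst hdk
        refine Or.inr ⟨b, hb, _, _, h.mul hd hb hbd.symm, ?_, ?_⟩
        · rw [mul_assoc, mul_assoc, ← swapLift_cyclic hkm.symm hbd.symm hbm.symm,
            swapLift_symm m d, swapLift_symm d b, neg_mul_neg]
        · rw [mul_assoc, mul_assoc, ← swap_cyclic hkm.symm hbd.symm hbm.symm, Equiv.swap_comm m d,
            Equiv.swap_comm b d]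
      refine Or.inr ⟨k, hk, _, _, (h.mul hb hd hbd).neg, ?_, ?_⟩
      · rw [neg_mul, mul_assoc, mul_assoc, ← mul_neg,
          swapLift_anticomm (Ne.symm hbk) (Ne.symm hdk) hbm.symm hdm.symm]
      · rw [mul_assoc, mul_assoc, swap_commute (Ne.symm hbk) (Ne.symm hdk) hbm.symm hdm.symm]

/-- The spin extension has kernel `{1, -1}`: the induction on `A` removes one point `m` at a time
by bringing the lift into the form of `SpinLift.insert_cases`. -/
theorem SpinLift.eq_one_or_eq_neg_one {A : Set n} {u} (h : SpinLift A u 1) : u = 1 ∨ u = -1 := by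
  induction A, A.toFinite using Set.Finite.induction_on generalizing u with
  | empty =>
    generalize (1 : Equiv.Perm n) = x at h
    induction h with
    | one => exact Or.inl rfl
    | neg _ ih => exact ih.elim (fun h => Or.inr (by rw [h])) (fun h => Or.inl (by rw [h, neg_neg]))
    | mul _ hb => exact absurd hb (Set.notMem_empty _)
  | @insert m A hm _ ih =>
    obtain h | ⟨k, hk, v, y, h, -, hy⟩ := h.insert_cases hm
    · exact ih h
    · -- a transposition moving `m` is not undone by a permutation fixing `m`
      have := congrArg (fun x : Equiv.Perm n => x k) hy
      simp only [Equiv.Perm.one_apply, Equiv.Perm.mul_apply, Equiv.swap_apply_left,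
        h.apply_eq hm] at this
      exact absurd (this ▸ hk) hm

theorem SpinLift.mul_lift {A : Set n} {u v x y} (hu : SpinLift A u x) (hv : SpinLift A v y) :
    SpinLift A (u * v) (x * y) := by
  induction hv with
  | one => simpa using hu
  | neg _ ih => simpa using ih.neg
  | mul _ hb hd hbd ih => simpa only [mul_assoc] using ih.mul hb hd hbd

theorem SpinLift.exists_inv {A : Set n} {u x} (hu : SpinLift A u x) :
    ∃ v, SpinLift A v x⁻¹ ∧ v * u = 1 ∧ u * v = 1 := by
  induction hu with
  | one => exact ⟨1, by simpa using .one, by simp, by simp⟩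
  | neg _ ih =>
    obtain ⟨v, hv, h₁, h₂⟩ := ih
    exact ⟨-v, hv.neg, by simpa using h₁, by simpa using h₂⟩
  | @mul u x b d _ hb hd hbd ih =>
    obtain ⟨v, hv, h₁, h₂⟩ := ih
    have hs : SpinLift A (swapLift b d) (Equiv.swap b d) := by
      simpa using SpinLift.one.mul hb hd hbd
    refine ⟨swapLift b d * v, by simpa using hs.mul_lift hv, ?_, ?_⟩
    · rw [mul_assoc, ← mul_assoc v, h₁, one_mul, swapLift_mul_self hbd]
    · rw [mul_assoc, ← mul_assoc _ _ v, swapLift_mul_self hbd, one_mul, h₂]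

theorem SpinLift.eq_or_eq_neg {A : Set n} {u v x} (hu : SpinLift A u x) (hv : SpinLift A v x) :
    u = v ∨ u = -v := by
  obtain ⟨w, hw, h₁, h₂⟩ := hv.exists_inv
  have := hu.mul_lift hw
  rw [mul_inv_cancel] at this
  refine this.eq_one_or_eq_neg_one.imp (fun h => ?_) (fun h => ?_)
  · rw [← mul_one u, ← h₁, ← mul_assoc, h, one_mul]
  · rw [← mul_one u, ← h₁, ← mul_assoc, h, neg_one_mul]

theorem exists_spinLift (x : Equiv.Perm n) : ∃ u, SpinLift Set.univ u x := by
  induction x using Equiv.Perm.swap_induction_on' with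
  | one => exact ⟨1, .one⟩
  | mul_swap f b d hbd ih =>
    obtain ⟨u, hu⟩ := ih
    exact ⟨_, hu.mul trivial trivial hbd⟩

/-- An arbitrary section of the spin extension of the symmetric group. -/
noncomputable def lift (x : Equiv.Perm n) : CliffordAlgebra (euclideanForm n) :=
  (exists_spinLift x).choose

theorem spinLift_lift (x : Equiv.Perm n) : SpinLift Set.univ (lift x) x :=
  (exists_spinLift x).choose_spec

/-- A sign is determined by its action on a lift, since lifts are invertible and `1 ≠ -1` in the
Clifford algebra. -/
theorem smul_lift_injective (x : Equiv.Perm n) :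
    Function.Injective fun ε : ℤˣ => ε • lift x := by
  obtain ⟨v, -, -, hv⟩ := (spinLift_lift x).exists_inv
  intro ε ε' h
  have h1 : ε • (1 : CliffordAlgebra (euclideanForm n)) = ε' • 1 := by
    rw [← hv, ← smul_mul_assoc, ← smul_mul_assoc]
    exact congrArg (· * v) h
  have : (1 : CliffordAlgebra (euclideanForm n)) ≠ -1 := by
    intro h
    refine two_ne_zero (α := ℝ) ((algebraMap ℝ (CliffordAlgebra (euclideanForm n))).injective ?_)
    rw [map_ofNat, map_zero, ← one_add_one_eq_two]
    nth_rewrite 1 [h]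
    exact neg_add_cancel 1
  obtain rfl | rfl := Int.units_eq_one_or ε <;> obtain rfl | rfl := Int.units_eq_one_or ε' <;>
    simp_all

open Classical in
/-- The sign `ε` with `lift x * swapLift b d = ε • lift (x * Equiv.swap b d)`; the value is
meaningful for `b ≠ d` only. -/
noncomputable def transitionSign (x : Equiv.Perm n) (b d : n) : ℤˣ :=
  if lift x * swapLift b d = lift (x * Equiv.swap b d) then 1 else -1

theorem lift_mul_swapLift (x : Equiv.Perm n) {b d : n} (hbd : b ≠ d) :
    lift x * swapLift b d = transitionSign x b d • lift (x * Equiv.swap b d) := by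
  rw [transitionSign]
  split_ifs with h
  · rw [h, one_smul]
  · rw [((spinLift_lift x).mul trivial trivial hbd).eq_or_eq_neg (spinLift_lift _)
      |>.resolve_left h, Units.neg_smul, one_smul]

theorem lift_mul_swapLift_mul_swapLift (x : Equiv.Perm n) {b d b' d' : n} (h : b ≠ d)
    (h' : b' ≠ d') :
    lift x * (swapLift b d * swapLift b' d') =
      (transitionSign x b d * transitionSign (x * Equiv.swap b d) b' d') •
        lift (x * Equiv.swap b d * Equiv.swap b' d') := by
  rw [← mul_assoc, lift_mul_swapLift x h, smul_mul_assoc, lift_mul_swapLift _ h', smul_smul]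

end Spin

/-! ### Sums of two rectangles -/

theorem sub_lt_sub_self {N : ℕ} [NeZero N] {a c : Fin N} (h : a ≠ c) : a - a < c - a := by
  rw [sub_self, Fin.pos_iff_ne_zero]
  exact sub_ne_zero.2 h.symm

theorem sub_lt_sub_rotate {N : ℕ} {a b c : Fin N} (hab : a ≠ b) (hbc : b ≠ c) (hac : a ≠ c) :
    b - a < c - a ↔ c - b < a - b := by
  have := a.2; have := b.2; have := c.2
  rw [Ne, Fin.ext_iff] at hab hbc hac
  simp only [Fin.lt_def, val_sub_eq]
  split_ifs <;> omega

theorem sub_lt_sub_swap {N : ℕ} [NeZero N] {a b c : Fin N} (hbc : b ≠ c) :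
    c - a < b - a ↔ ¬ b - a < c - a := by
  rw [not_lt, le_iff_lt_or_eq, or_iff_left (sub_left_injective.ne hbc.symm)]

/-- The six cyclic intervals with distinct end points among `a`, `b`, `c`, tested on the third
point, are governed by one bit: whether `a`, `b`, `c` are in cyclic order. -/
theorem cyclic_order_iffs {N : ℕ} [NeZero N] {a b c : Fin N} (hab : a ≠ b) (hbc : b ≠ c)
    (hac : a ≠ c) :
    (c - b < a - b ↔ b - a < c - a) ∧ (a - c < b - c ↔ b - a < c - a) ∧
    (c - a < b - a ↔ ¬ b - a < c - a) ∧ (a - b < c - b ↔ ¬ b - a < c - a) ∧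
    (b - c < a - c ↔ ¬ b - a < c - a) := by
  have h₁ := sub_lt_sub_rotate hab hbc hac
  have h₂ := sub_lt_sub_rotate hbc hac.symm hab.symm
  refine ⟨h₁.symm, (h₁.trans h₂).symm, sub_lt_sub_swap hbc, ?_, ?_⟩
  · rw [sub_lt_sub_swap hac.symm, h₁]
  · rw [sub_lt_sub_swap hab, h₁, h₂]

/-- The case of three moved rows. The two products of lifts agree up to sign by `swapLift_cyclic`;
the sign is the product of the four orientations, and it must be `-1` since otherwise the two sums
of rectangles differ already at the nine squares in the columns of `x i`, `x j`, `x k` and the rows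
`i`, `j`, `k`. -/
theorem swapLift_mul_of_three_cycle {N : ℕ} [NeZero N] (x : Generator N)
    {i j k b₁ d₁ b₂ d₂ b₁' d₁' b₂' d₂' : Fin N}
    (hij : i ≠ j) (hjk : j ≠ k) (hik : i ≠ k)
    (h₁ : Joins b₁ d₁ i j) (h₂ : Joins b₂ d₂ j k) (h₁' : Joins b₁' d₁' j k)
    (h₂' : Joins b₂' d₂' k i)
    (h : block (x b₁) (x d₁) b₁ d₁ +
        block ((x * Equiv.swap b₁ d₁) b₂) ((x * Equiv.swap b₁ d₁) d₂) b₂ d₂ =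
      block (x b₁') (x d₁') b₁' d₁' +
        block ((x * Equiv.swap b₁' d₁') b₂') ((x * Equiv.swap b₁' d₁') d₂') b₂' d₂') :
    swapLift b₁ d₁ * swapLift b₂ d₂ = -(swapLift b₁' d₁' * swapLift b₂' d₂') := by
  have e := fun u v => congrFun h (x u, v)
  have hx : ∀ {u v}, u ≠ v → x u ≠ x v := fun h => x.injective.ne h
  obtain ⟨c₁, c₂, c₃, c₄, c₅⟩ := cyclic_order_iffs (hx hij) (hx hjk) (hx hik)
  obtain ⟨r₁, r₂, r₃, r₄, r₅⟩ := cyclic_order_iffs hij hjk hik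
  have t := swapLift_cyclic hij hjk hik
  have s₁ := swapLift_symm i j
  have s₂ := swapLift_symm j k
  have s₃ := swapLift_symm k i
  rcases h₁ with ⟨e₁, e₂⟩ | ⟨e₁, e₂⟩ <;> rcases h₂ with ⟨e₃, e₄⟩ | ⟨e₃, e₄⟩ <;>
  rcases h₁' with ⟨e₅, e₆⟩ | ⟨e₅, e₆⟩ <;> rcases h₂' with ⟨e₇, e₈⟩ | ⟨e₇, e₈⟩ <;>
  rw [e₁, e₂, e₃, e₄, e₅, e₆, e₇, e₈] at e ⊢ <;>
  clear e₁ e₂ e₃ e₄ e₅ e₆ e₇ e₈ h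
  -- orientations with product `-1`
  any_goals
    simp only [s₁, s₂, s₃, neg_mul, mul_neg, neg_neg, t]
    done
  -- orientations with product `1`
  all_goals
    exfalso
    have e₁ := e i i
    have e₂ := e i j
    have e₃ := e i k
    have e₄ := e j i
    have e₅ := e j j
    have e₆ := e j k
    have e₇ := e k i
    have e₈ := e k j
    have e₉ := e k k
    clear e
    simp only [block, Pi.add_apply, Equiv.Perm.mul_apply, Equiv.swap_apply_left,
      Equiv.swap_apply_right, Equiv.swap_apply_of_ne_of_ne hij hik, Equiv.swap_apply_of_ne_of_ne
      hik.symm hjk.symm, Equiv.swap_apply_of_ne_of_ne hik hij, Equiv.swap_apply_of_ne_of_ne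
      hjk.symm hik.symm, sub_lt_sub_self, hij, hjk, hik, hij.symm, hjk.symm, hik.symm, hx hij, hx
      hjk, hx hik, hx hij.symm, hx hjk.symm, hx hik.symm, c₁, c₂, c₃, c₄, c₅, r₁, r₂, r₃, r₄, r₅,
      lt_irrefl, Ne, not_false_eq_true, true_and, and_true, false_and, and_false, if_true,
      if_false] at e₁ e₂ e₃ e₄ e₅ e₆ e₇ e₈ e₉
    -- the two bits are the cyclic orders of the three columns and of the three rows
    by_cases C : x j - x i < x k - x i <;> by_cases D : j - i < k - i <;>
      simp [C, D] at e₁ e₂ e₃ e₄ e₅ e₆ e₇ e₈ e₉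

/-- The case of two disjoint pairs of rows. If exactly one of the two pairs were traversed in
opposite orientations, a rectangle would coincide with the complementary one in its rows. -/
theorem swapLift_mul_of_disjoint {N : ℕ} [NeZero N] (x : Generator N)
    {b₁ d₁ b₂ d₂ b₁' d₁' b₂' d₂' : Fin N}
    (hbd₁ : b₁ ≠ d₁) (hbd₂ : b₂ ≠ d₂)
    (hbb : b₁ ≠ b₂) (hbd : b₁ ≠ d₂) (hdb : d₁ ≠ b₂) (hdd : d₁ ≠ d₂)
    (h₁' : Joins b₁' d₁' b₂ d₂) (h₂' : Joins b₂' d₂' b₁ d₁)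
    (h : block (x b₁) (x d₁) b₁ d₁ +
        block ((x * Equiv.swap b₁ d₁) b₂) ((x * Equiv.swap b₁ d₁) d₂) b₂ d₂ =
      block (x b₁') (x d₁') b₁' d₁' +
        block ((x * Equiv.swap b₁' d₁') b₂') ((x * Equiv.swap b₁' d₁') d₂') b₂' d₂') :
    swapLift b₁ d₁ * swapLift b₂ d₂ = -(swapLift b₁' d₁' * swapLift b₂' d₂') := by
  have e₁ := congrFun h (x b₁, b₁)
  have e₂ := congrFun h (x b₂, b₂)
  simp only [block, Pi.add_apply, Equiv.Perm.mul_apply] at e₁ e₂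
  rw [swapLift_anticomm hbb hbd hdb hdd]
  rcases h₁' with ⟨rfl, rfl⟩ | ⟨rfl, rfl⟩ <;> rcases h₂' with ⟨rfl, rfl⟩ | ⟨rfl, rfl⟩
  · rfl
  · exfalso
    simp [Equiv.swap_apply_of_ne_of_ne, Fin.pos_iff_ne_zero, sub_eq_zero, *, Ne.symm] at e₁
  · exfalso
    simp [Equiv.swap_apply_of_ne_of_ne, Fin.pos_iff_ne_zero, sub_eq_zero, *, Ne.symm] at e₂
  · rw [swapLift_symm d₂' b₂', swapLift_symm d₁' b₁', neg_mul_neg]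

/-- If two pairs of rectangles from `x` through different intermediate generators have the same sum
and the same end point, then the associated products of lifts are opposite. This is the relation
that makes the spin extension produce a sign assignment. -/
theorem swapLift_mul_swapLift_eq_neg {N : ℕ} [NeZero N] (x : Generator N)
    {b₁ d₁ b₂ d₂ b₁' d₁' b₂' d₂' : Fin N} (hbd₁ : b₁ ≠ d₁) (hbd₂ : b₂ ≠ d₂)
    (hperm : Equiv.swap b₁ d₁ * Equiv.swap b₂ d₂ = Equiv.swap b₁' d₁' * Equiv.swap b₂' d₂')
    (hne : Equiv.swap b₁ d₁ ≠ Equiv.swap b₁' d₁') (hne' : Equiv.swap b₁ d₁ ≠ Equiv.swap b₂ d₂)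
    (h : block (x b₁) (x d₁) b₁ d₁ +
        block ((x * Equiv.swap b₁ d₁) b₂) ((x * Equiv.swap b₁ d₁) d₂) b₂ d₂ =
      block (x b₁') (x d₁') b₁' d₁' +
        block ((x * Equiv.swap b₁' d₁') b₂') ((x * Equiv.swap b₁' d₁') d₂') b₂' d₂') :
    swapLift b₁ d₁ * swapLift b₂ d₂ = -(swapLift b₁' d₁' * swapLift b₂' d₂') := by
  have hne₁ : ¬ Joins b₁' d₁' b₁ d₁ := fun h => hne h.swap_eq.symm
  have hne₂ : ¬ Joins b₁ d₁ b₂ d₂ := fun h => hne' h.swap_eq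
  have of_shared : ∀ i j k, i ≠ j → j ≠ k → i ≠ k → Joins b₁ d₁ i j → Joins b₂ d₂ j k →
      swapLift b₁ d₁ * swapLift b₂ d₂ = -(swapLift b₁' d₁' * swapLift b₂' d₂') := by
    intro i j k hij hjk hik h₁ h₂
    have hn : ¬ Joins b₁' d₁' i j := fun h' => hne (h₁.swap_eq.trans h'.swap_eq.symm)
    rw [h₁.swap_eq, h₂.swap_eq] at hperm
    obtain ⟨h₁', h₂'⟩ | ⟨h₁', h₂'⟩ := joins_of_three_cycle hij hjk hik hperm hn
    · exact swapLift_mul_of_three_cycle x hij hjk hik h₁ h₂ h₁' h₂' h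
    · rw [swapLift_mul_of_three_cycle x hik.symm hij hjk.symm h₁' h₂' h₁ h₂ h.symm, neg_neg]
  by_cases hbb : b₁ = b₂
  · exact of_shared d₁ b₁ d₂ hbd₁.symm (hbb ▸ hbd₂) (fun e => hne₂ (.inl ⟨hbb, e⟩))
      (.inr ⟨rfl, rfl⟩) (.inl ⟨hbb.symm, rfl⟩)
  by_cases hbd : b₁ = d₂
  · exact of_shared d₁ b₁ b₂ hbd₁.symm hbb (fun e => hne₂ (.inr ⟨hbd, e⟩))
      (.inr ⟨rfl, rfl⟩) (.inr ⟨rfl, hbd.symm⟩)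
  by_cases hdb : d₁ = b₂
  · exact of_shared b₁ d₁ d₂ hbd₁ (hdb ▸ hbd₂) hbd (.inl ⟨rfl, rfl⟩) (.inl ⟨hdb.symm, rfl⟩)
  by_cases hdd : d₁ = d₂
  · exact of_shared b₁ d₁ b₂ hbd₁ hdb hbb (.inl ⟨rfl, rfl⟩) (.inr ⟨rfl, hdd.symm⟩)
  obtain ⟨h₁', h₂'⟩ := joins_of_disjoint hbd₁ hbd₂ hbb hbd hdb hdd hperm hne₁
  exact swapLift_mul_of_disjoint x hbd₁ hbd₂ hbb hbd hdb hdd h₁' h₂' h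

/-! ### The sign assignment of the spin extension -/

theorem Rectangle.exists_rows {N : ℕ} [NeZero N] {x y : Generator N} (R : Rectangle x y) :
    ∃ e : Fin N × Fin N, e.1 ≠ e.2 ∧ y = x * Equiv.swap e.1 e.2 ∧
      R.1 = block (x e.1) (x e.2) e.1 e.2 := by
  obtain ⟨R, a, c, b, d, -, hbd, hR, hx₁, hx₂, hy₁, hy₂, hcard, -⟩ := R
  refine ⟨(b, d), hbd, IsRectangle.generator_eq hbd hx₁ hx₂ hy₁ hy₂ hcard, ?_⟩
  rw [hx₁, hx₂]
  exact funext fun e => hR e.1 e.2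

/-- The rows `(b, d)` of a rectangle: its bottom and top sides lie on `α_b` and `α_d`. -/
noncomputable def Rectangle.rows {N : ℕ} [NeZero N] {x y : Generator N} (R : Rectangle x y) :
    Fin N × Fin N :=
  R.exists_rows.choose

section Rows

variable {N : ℕ} [NeZero N] {x y : Generator N} (R : Rectangle x y)

theorem Rectangle.rows_ne : R.rows.1 ≠ R.rows.2 := R.exists_rows.choose_spec.1

theorem Rectangle.target_eq : y = x * Equiv.swap R.rows.1 R.rows.2 := R.exists_rows.choose_spec.2.1

theorem Rectangle.chain_eq : R.1 = block (x R.rows.1) (x R.rows.2) R.rows.1 R.rows.2 :=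
  R.exists_rows.choose_spec.2.2

end Rows

theorem lift_mul_rectangles {N : ℕ} [NeZero N] {x y z : Generator N} (R₁ : Rectangle x z)
    (R₂ : Rectangle z y) :
    lift x * (swapLift R₁.rows.1 R₁.rows.2 * swapLift R₂.rows.1 R₂.rows.2) =
      (transitionSign x R₁.rows.1 R₁.rows.2 * transitionSign z R₂.rows.1 R₂.rows.2) • lift y := by
  have h := lift_mul_swapLift_mul_swapLift x R₁.rows_ne R₂.rows_ne
  rwa [← R₁.target_eq, ← R₂.target_eq] at h

/-- The sign assignment that measures, for a rectangle from `x` to `y`, the discrepancy between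
`lift y` and the lift of `x` multiplied by the unit vector of the rectangle. -/
noncomputable def spinSignAssignment (N : ℕ) [NeZero N] : SignAssignment N where
  sign x _ R := transitionSign x R.rows.1 R.rows.2
  anticomm x y z z' hnodup R₁ R₂ R₁' R₂' hsum := by
    apply smul_lift_injective y
    simp only [Units.neg_smul]
    rw [← lift_mul_rectangles R₁ R₂, ← lift_mul_rectangles R₁' R₂', ← mul_neg]
    congr 1
    have hxy : x ≠ y := by simp_all
    have hzz : z ≠ z' := by simp_all
    have hz := R₁.target_eq
    have hz' := R₁'.target_eq
    have hy := R₂.target_eq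
    have hy' := R₂'.target_eq
    rw [R₁.chain_eq, R₂.chain_eq, R₁'.chain_eq, R₂'.chain_eq] at hsum
    have h₁ := R₁.rows_ne
    have h₂ := R₂.rows_ne
    generalize R₁.rows = e₁ at *
    generalize R₂.rows = e₂ at *
    generalize R₁'.rows = e₁' at *
    generalize R₂'.rows = e₂' at *
    subst hz hz'
    refine swapLift_mul_swapLift_eq_neg x h₁ h₂ ?_ ?_ ?_ hsum
    · have := hy.symm.trans hy'
      rwa [mul_assoc, mul_assoc, mul_right_inj] at this
    · exact fun h => hzz (by rw [h])
    · intro h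
      rw [← h, mul_assoc, Equiv.swap_mul_self, mul_one] at hy
      exact hxy hy.symm

/-! ### Values on the annuli -/

/-- The decomposition of `D` starting at the intermediate generator. -/
def Decomposition.rotate {N : ℕ} [NeZero N] {x : Generator N} {D : Chain N}
    (d : Decomposition x x D) : Decomposition d.mid d.mid D :=
  ⟨x, d.snd, d.fst, by rw [add_comm, d.sum_eq]⟩

section Annuli

variable {N : ℕ} [N.AtLeastTwo] {x y : Generator N}

theorem Rectangle.rows_of_horizontal (R : Rectangle x y) {i : Fin N}
    (h : ∀ p q, q ≠ i → R.1 (p, q) = 0) : R.rows.1 = i ∧ R.rows.2 = i + 1 := by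
  refine eq_of_interval R.rows_ne fun q hq => ?_
  by_contra hne
  have h0 := h (x R.rows.1) q hne
  rw [R.chain_eq, block, if_pos ⟨sub_lt_sub_self (x.injective.ne R.rows_ne), hq⟩] at h0
  exact one_ne_zero h0

theorem Rectangle.columns_of_vertical (R : Rectangle x y) {i : Fin N}
    (h : ∀ p q, p ≠ i → R.1 (p, q) = 0) : x R.rows.1 = i ∧ x R.rows.2 = i + 1 := by
  refine eq_of_interval (x.injective.ne R.rows_ne) fun p hp => ?_
  by_contra hne
  have h0 := h p R.rows.1 hne
  rw [R.chain_eq, block, if_pos ⟨hp, sub_lt_sub_self R.rows_ne⟩] at h0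
  exact one_ne_zero h0

/-- Both rectangles of `H_i` go up from row `i` to row `i + 1`, and `swapLift i (i + 1)` squares
to `1`. -/
theorem spinSignAssignment_horizontal {i : Fin N} (d : Decomposition x x (horizontalAnnulus i)) :
    d.sign (spinSignAssignment N) = 1 := by
  have h0 : ∀ p q, q ≠ i → horizontalAnnulus (N := N) i (p, q) = 0 := fun p q h => if_neg h
  obtain ⟨h₁, h₂⟩ := d.fst.rows_of_horizontal fun p q h => d.zero_of_zero (h0 p q h)
  obtain ⟨h₃, h₄⟩ := d.snd.rows_of_horizontal fun p q h => d.rotate.zero_of_zero (h0 p q h)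
  apply smul_lift_injective x
  change (transitionSign _ _ _ * transitionSign _ _ _) • lift x = (1 : ℤˣ) • lift x
  rw [← lift_mul_rectangles, h₁, h₂, h₃, h₄, swapLift_mul_self (ne_add_one i), mul_one, one_smul]

/-- The two rectangles of `V_i` transpose the same two rows in opposite orientations, and
`swapLift b d * swapLift d b = -1`. -/
theorem spinSignAssignment_vertical {i : Fin N} (d : Decomposition x x (verticalAnnulus i)) :
    d.sign (spinSignAssignment N) = -1 := by
  have h0 : ∀ p q, p ≠ i → verticalAnnulus (N := N) i (p, q) = 0 := fun p q h => if_neg h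
  obtain ⟨h₁, h₂⟩ := d.fst.columns_of_vertical fun p q h => d.zero_of_zero (h0 p q h)
  obtain ⟨h₃, h₄⟩ := d.snd.columns_of_vertical fun p q h => d.rotate.zero_of_zero (h0 p q h)
  have hm (j) : d.mid j = x (Equiv.swap d.fst.rows.1 d.fst.rows.2 j) :=
    congrArg (fun z : Generator N => z j) d.fst.target_eq
  rw [hm] at h₃ h₄
  have h₃' : d.snd.rows.1 = d.fst.rows.2 :=
    (Equiv.swap_apply_eq_iff.1 (x.injective (h₃.trans h₁.symm))).trans (Equiv.swap_apply_left _ _)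
  have h₄' : d.snd.rows.2 = d.fst.rows.1 :=
    (Equiv.swap_apply_eq_iff.1 (x.injective (h₄.trans h₂.symm))).trans (Equiv.swap_apply_right _ _)
  apply smul_lift_injective x
  change (transitionSign _ _ _ * transitionSign _ _ _) • lift x = (-1 : ℤˣ) • lift x
  rw [← lift_mul_rectangles, h₃', h₄', swapLift_symm d.fst.rows.1, mul_neg,
    swapLift_mul_self d.fst.rows_ne, mul_neg, mul_one, Units.neg_smul, one_smul]

end Annuli

/-! ### Twisting by signs of the elementary domains -/

section Twist

variable {N : ℕ}

/-- The multiplicative extension to 2-chains of a choice of signs of the elementary domains. -/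
def chainSign (c : Fin N × Fin N → ℤˣ) (D : Chain N) : ℤˣ := ∏ e, c e ^ D e

theorem chainSign_add (c : Fin N × Fin N → ℤˣ) (D D' : Chain N) :
    chainSign c (D + D') = chainSign c D * chainSign c D' := by
  simp only [chainSign, Pi.add_apply, zpow_add, Finset.prod_mul_distrib]

theorem chainSign_horizontalAnnulus (c : Fin N × Fin N → ℤˣ) (i : Fin N) :
    chainSign c (horizontalAnnulus i) = ∏ p, c (p, i) := by
  simp [chainSign, horizontalAnnulus, Fintype.prod_prod_type, pow_ite]

theorem chainSign_verticalAnnulus (c : Fin N × Fin N → ℤˣ) (i : Fin N) :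
    chainSign c (verticalAnnulus i) = ∏ q, c (i, q) := by
  rw [chainSign, Fintype.prod_prod_type_right]
  simp [verticalAnnulus, pow_ite]

/-- Twisting a sign assignment by signs of the elementary domains. The factors of two
consecutive rectangles multiply to `chainSign` of their sum, so anticommutation is preserved. -/
def SignAssignment.twist [NeZero N] (s : SignAssignment N) (c : Fin N × Fin N → ℤˣ) :
    SignAssignment N where
  sign x y R := s.sign x y R * chainSign c R.1
  anticomm x y z z' hnodup R₁ R₂ R₁' R₂' hsum := by
    have h : chainSign c R₁.1 * chainSign c R₂.1 = chainSign c R₁'.1 * chainSign c R₂'.1 :=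
      (chainSign_add c _ _).symm.trans ((congrArg _ hsum).trans (chainSign_add c _ _))
    rw [mul_mul_mul_comm, h, s.anticomm x y z z' hnodup R₁ R₂ R₁' R₂' hsum, neg_mul,
      mul_mul_mul_comm]

theorem Decomposition.sign_twist [NeZero N] {x y : Generator N} {D : Chain N}
    (d : Decomposition x y D) (s : SignAssignment N) (c : Fin N × Fin N → ℤˣ) :
    d.sign (s.twist c) = d.sign s * chainSign c D := by
  have h : chainSign c d.fst.1 * chainSign c d.snd.1 = chainSign c D :=
    (chainSign_add c _ _).symm.trans (congrArg _ d.sum_eq)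
  rw [← h]
  exact mul_mul_mul_comm _ _ _ _

/-- A matrix of signs with prescribed row products `g` and column products `k` exists as soon as the
total products agree. -/
theorem exists_prod_eq [NeZero N] {g k : Fin N → ℤˣ} (h : ∏ p, k p = ∏ q, g q) :
    ∃ c : Fin N × Fin N → ℤˣ, (∀ q, ∏ p, c (p, q) = g q) ∧ ∀ p, ∏ q, c (p, q) = k p := by
  -- all entries outside the row and the column of index `0` are `1`
  refine ⟨fun e => (if e.2 = 0 then k e.1 else 1) * (if e.1 = 0 then g e.2 else 1) *
    (if e.1 = 0 then if e.2 = 0 then ∏ q, g q else 1 else 1), fun q => ?_, fun p => ?_⟩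
  · simp only [Finset.prod_mul_distrib]
    by_cases hq : q = 0 <;> simp [hq, h, mul_right_comm, Int.units_mul_self]
  · simp only [Finset.prod_mul_distrib]
    by_cases hp : p = 0 <;> simp [hp, mul_assoc, Int.units_mul_self]

end Twist

theorem exists_signAssignment {N : ℕ} [N.AtLeastTwo] {g_h g_v : Fin N → ℤˣ}
    (h : ∏ p, -g_v p = ∏ q, g_h q) :
    ∃ s : SignAssignment N, ∀ x, horizontal s x = g_h ∧ vertical s x = g_v := by
  obtain ⟨c, hc, hc'⟩ := exists_prod_eq h
  refine ⟨(spinSignAssignment N).twist c, fun x => ⟨funext fun i => ?_, funext fun i => ?_⟩⟩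
  · rw [horizontal, Decomposition.sign_twist, spinSignAssignment_horizontal,
      chainSign_horizontalAnnulus, hc, one_mul]
  · rw [vertical, Decomposition.sign_twist, spinSignAssignment_vertical,
      chainSign_verticalAnnulus, hc', neg_mul_neg, one_mul]

theorem prod_eq_neg_one_pow {ι : Type*} [Fintype ι] (g : ι → ℤˣ) :
    ∏ i, g i = (-1) ^ (Finset.univ.filter fun i => g i = -1).card := by
  rw [← Finset.prod_const, Finset.prod_filter]
  refine Finset.prod_congr rfl fun i _ => ?_
  split_ifs with h
  · exact h
  · exact (Int.units_eq_one_or _).resolve_right h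

end Grid

theorem mainTheorem8 (N : ℕ) [N.AtLeastTwo] :
    (∀ g_h g_v : Fin N → ℤˣ,
      (Finset.univ.filter fun i => g_v i = 1).card ≡
        (Finset.univ.filter fun i => g_h i = -1).card [MOD 2] →
      ∃ s : Grid.SignAssignment N, ∀ x : Grid.Generator N,
        Grid.horizontal s x = g_h ∧ Grid.vertical s x = g_v) ∧
    ∀ x : Grid.Generator N, Function.Surjective (Grid.Phi x) := by
  refine ⟨fun g_h g_v h => Grid.exists_signAssignment ?_, fun x ⟨g, k⟩ => ?_⟩
  · rw [Grid.prod_eq_neg_one_pow, Grid.prod_eq_neg_one_pow g_h]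
    simp only [neg_inj]
    rw [Int.units_pow_eq_pow_mod_two, show _ % 2 = _ % 2 from h, ← Int.units_pow_eq_pow_mod_two]
  · have hN : N - 1 < N := Nat.sub_one_lt (NeZero.ne N)
    -- `f` extends `k` by `1`; the parity condition forces the value `w` at the last column
    let f : Fin N → ℤˣ := fun j => if hj : (j : ℕ) < N - 1 then k ⟨j, hj⟩ else 1
    let w : ℤˣ := (∏ j, -f j) * ∏ i, g i
    obtain ⟨s, hs⟩ := Grid.exists_signAssignment (g_h := g)
      (g_v := fun j => f j * Pi.mulSingle (M := fun _ => ℤˣ) ⟨N - 1, hN⟩ w j) (by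
        simp only [← neg_mul, Finset.prod_mul_distrib, Finset.prod_pi_mulSingle']
        simp [w, ← mul_assoc, Int.units_mul_self])
    refine ⟨Quotient.mk _ s, Prod.ext (hs x).1 (funext fun j => ?_)⟩
    refine (congrFun (hs x).2 _).trans ?_
    have hj : Fin.castLE (Nat.sub_le N 1) j ≠ ⟨N - 1, hN⟩ := fun e =>
      j.2.ne (congrArg Fin.val e)
    simp [f, Pi.mulSingle_eq_of_ne hj]
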